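/- Let $F = F(x,y)$ be the free group on two generators $x$ and $y$. The exponent sum pair of $w \in F$ is the pair of integers $(X,Y)$, where $X$ is the exponent sum of $x$ in $w$ and $Y$ is the exponent sum of $y$ in $w$. An element of $F$ is called primitive if it is the image of $x$ under some automorphism of $F$. **Lemma (Nielsen).** Each conjugacy class of primitive elements of $F$ is determined uniquely by its exponent sum pair. That is, if $p \in F$ is primitive, then the conjugacy class of $p$ consists exactly of the primitive elements $q \in F$ that have the same exponent sum pair as $p$. In particular, two primitive elements of $F$ are conjugate if and only if they have the same exponent sum pair. -/

import Mathlib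

/-- The free group `F(x, y)` of rank two; the generators are `F2.x` and `F2.y`. -/
abbrev F2 : Type := FreeGroup (Fin 2)

/-- The generator `x`. -/
def F2.x : F2 := FreeGroup.of 0

/-- The generator `y`. -/
def F2.y : F2 := FreeGroup.of 1

/-- An element of `F(x, y)` is primitive if it is the image of `x` under some automorphism. -/
def F2.IsPrimitive (w : F2) : Prop := ∃ θ : F2 ≃* F2, θ F2.x = w

/-- The exponent sum of the `i`-th generator in `w`: the value at `w` of the homomorphism to `ℤ`
that sends the `i`-th generator to `1` and the other generator to `0`. -/
def F2.exponentSum (i : Fin 2) (w : F2) : ℤ :=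
  Multiplicative.toAdd
    (FreeGroup.lift (fun j : Fin 2 => Multiplicative.ofAdd (if j = i then (1 : ℤ) else 0)) w)

/-- For any word representing an element, the exponent sum is the number of occurrences of the
generator minus the number of occurrences of its inverse. -/
theorem F2.exponentSum_mk (i : Fin 2) (L : List (Fin 2 × Bool)) :
    F2.exponentSum i (FreeGroup.mk L) = (L.count (i, true) : ℤ) - (L.count (i, false) : ℤ) := by
  unfold F2.exponentSum
  rw [FreeGroup.lift_mk]
  induction L with
  | nil => simp
  | cons a L ih =>
    obtain ⟨j, b⟩ := a
    rw [List.map_cons, List.prod_cons, toAdd_mul, ih, List.count_cons, List.count_cons]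
    by_cases h : j = i <;> cases b <;> simp [h] <;> ring

/-- The exponent sum pair `(X, Y)` of `w`. -/
def F2.exponentSumPair (w : F2) : ℤ × ℤ := (F2.exponentSum 0 w, F2.exponentSum 1 w)

/-! Applying the inverse of the automorphism that defines `p`, one may take `p = x`; then `q` is
primitive with exponent sum pair `(1, 0)` and belongs to a generating pair. The key fact is
`F2.monotonePair_of_closure_eq_top`: up to a common conjugation and inversion of entries, every
generating pair consists of positive words in `a = x^±1` and `b = y^±1`. A positive word with
`y`-sum zero contains no `b`, so `q` is conjugate to a power of `x`, and its `x`-sum makes the power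
`1`. For the key fact, generation and monotonicity are both stable under Nielsen moves and
conjugation, and these are reversible, so a counterexample may be taken of least total length.
Minimality makes it Nielsen reduced, so a reduced word of two or more letters in it has length at
least two. Hence `x` and `y` are themselves entries up to inversion, and the pair is monotone after
all. -/

namespace FreeGroup

/-! ### Word length in a free group as a tree metric -/

variable {α : Type*} [DecidableEq α]

/-- The length of the longest common prefix of two lists. -/
def commonPrefixLength {β : Type*} [DecidableEq β] : List β → List β → ℕ
  | a :: L, b :: M => if a = b then commonPrefixLength L M + 1 else 0
  | [], _ => 0
  | _ :: _, [] => 0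

/-- The ultrametric inequality, source of both four-point conditions. -/
theorem min_commonPrefixLength_le {β : Type*} [DecidableEq β] (L M K : List β) :
    min (commonPrefixLength L M) (commonPrefixLength M K) ≤ commonPrefixLength L K := by
  induction L generalizing M K with
  | nil => simp [commonPrefixLength]
  | cons a L ih =>
    rcases M with _ | ⟨b, M⟩
    · simp [commonPrefixLength]
    rcases K with _ | ⟨c, K⟩
    · simp [commonPrefixLength]
    have := ih M K
    simp only [commonPrefixLength]
    split_ifs <;> first | omega | (subst_vars; contradiction)

theorem commonPrefixLength_comm {β : Type*} [DecidableEq β] (L M : List β) :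
    commonPrefixLength L M = commonPrefixLength M L := by
  induction L generalizing M with
  | nil => cases M <;> simp [commonPrefixLength]
  | cons a L ih =>
    rcases M with _ | ⟨b, M⟩
    · simp [commonPrefixLength]
    · simp only [commonPrefixLength, ih M, eq_comm]

theorem isReduced_invRev {L : List (α × Bool)} (h : IsReduced L) : IsReduced (invRev L) := by
  rw [isReduced_iff_reduce_eq] at h ⊢
  rw [reduce_invRev, h]

theorem norm_mk_invRev_mul_mk {L M : List (α × Bool)} (hL : IsReduced L) (hM : IsReduced M) :
    norm ((mk L)⁻¹ * mk M) + 2 * commonPrefixLength L M = L.length + M.length := by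
  induction L generalizing M with
  | nil => simp [commonPrefixLength, norm, hM.reduce_eq, ← one_eq_mk]
  | cons a L ih =>
    rcases M with _ | ⟨b, M⟩
    · rw [← one_eq_mk, mul_one, norm_inv_eq]
      simp [commonPrefixLength, norm, hL.reduce_eq]
    by_cases hab : a = b
    · subst hab
      have hcancel : (mk (a :: L))⁻¹ * mk (a :: M) = (mk L)⁻¹ * mk M := by
        have (K : List (α × Bool)) : mk (a :: K) = mk [a] * mk K := by simp
        rw [this L, this M]
        group
      have := ih (M := M) (hL.infix ⟨[a], [], by simp⟩) (hM.infix ⟨[a], [], by simp⟩)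
      rw [hcancel]
      simp only [commonPrefixLength, if_true, List.length_cons]
      omega
    · have hred : IsReduced (invRev (a :: L) ++ b :: M) := by
        refine List.IsChain.append (isReduced_invRev hL) hM ?_
        intro p hp q hq hpq
        simp [invRev] at hp hq
        subst hp hq
        by_contra hne
        apply hab
        ext
        · exact hpq
        · simpa using hne
      rw [inv_mk, mul_mk, norm, toWord_mk, hred.reduce_eq]
      simp [commonPrefixLength, hab]

theorem norm_inv_mul (g h : FreeGroup α) :
    norm (g⁻¹ * h) + 2 * commonPrefixLength g.toWord h.toWord = norm g + norm h := by
  simpa [norm, mk_toWord] using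
    norm_mk_invRev_mul_mk (isReduced_toWord (x := g)) (isReduced_toWord (x := h))

theorem norm_mul_mod_two (g h : FreeGroup α) : norm (g * h) % 2 = (norm g + norm h) % 2 := by
  have := norm_inv_mul g⁻¹ h
  rw [inv_inv, norm_inv_eq] at this
  omega

/-- The four-point condition for the word metric of a free group. -/
theorem four_point (a b c : FreeGroup α) :
    norm (a * b) + norm (b * c) ≤ max (norm a + norm c) (norm (a * b * c) + norm b) := by
  have h1 := norm_inv_mul a⁻¹ b
  have h2 := norm_inv_mul b (b * c)
  have h3 := norm_inv_mul a⁻¹ (b * c)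
  have h4 := min_commonPrefixLength_le a⁻¹.toWord (b * c).toWord b.toWord
  have h5 := commonPrefixLength_comm b.toWord (b * c).toWord
  simp only [inv_inv, norm_inv_eq, ← mul_assoc, inv_mul_cancel, one_mul] at h1 h2 h3
  omega

/-- The points `a⁻¹`, `1`, `b`, `b * c` of the Cayley tree have three sums of opposite distances;
this bounds another of them by the other two. -/
theorem four_point' (a b c : FreeGroup α) :
    norm (a * b * c) + norm b ≤ max (norm a + norm c) (norm (a * b) + norm (b * c)) := by
  have h1 := norm_inv_mul a⁻¹ b
  have h2 := norm_inv_mul b (b * c)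
  have h3 := norm_inv_mul a⁻¹ (b * c)
  have h4 := min_commonPrefixLength_le a⁻¹.toWord b.toWord (b * c).toWord
  simp only [inv_inv, norm_inv_eq, ← mul_assoc, inv_mul_cancel, one_mul] at h1 h2 h3
  omega

/-- The cancellations at the two ends of `b` do not overlap, so they add up. -/
theorem norm_mul_mul_add_norm {a b c : FreeGroup α}
    (h : norm a + norm c < norm (a * b) + norm (b * c)) :
    norm (a * b * c) + norm b = norm (a * b) + norm (b * c) := by
  have h1 := four_point a b c
  have h2 := four_point' a b c
  omega

/-- Write `a` as `c r c⁻¹` with `r` cyclically reduced and nonempty: squaring only doubles `r`. -/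
theorem norm_lt_norm_mul_self {a : FreeGroup α} (ha : a ≠ 1) : norm a < norm (a * a) := by
  have h1 := reduceCyclically.reduce_flatten_replicate_succ (isReduced_toWord (x := a)) 1
  have h2 := congrArg List.length (reduceCyclically.conj_conjugator_reduceCyclically a.toWord)
  have h3 : (a * a).toWord = reduce ((List.replicate (1 + 1) a.toWord).flatten) := by
    simp [toWord_mul, List.replicate_succ]
  have h4 : reduceCyclically a.toWord ≠ [] := by
    intro h
    apply ha
    have := reduceCyclically.conj_conjugator_reduceCyclically a.toWord
    rw [h] at this
    rw [← mk_toWord (x := a), ← this, List.append_nil, ← mul_mk, ← inv_mk, mul_inv_cancel]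
  have h5 := List.length_pos_iff.2 h4
  have h6 := congrArg List.length h1
  rw [← h3] at h6
  simp [List.replicate_succ] at h2 h6
  simp only [norm]
  omega

theorem exists_mul_norm_eq (b : FreeGroup α) (k : ℕ) (hk : k ≤ norm b) :
    ∃ p q : FreeGroup α, b = p * q ∧ norm p = k ∧ norm q = norm b - k := by
  have hb := isReduced_toWord (x := b)
  refine ⟨mk (b.toWord.take k), mk (b.toWord.drop k), ?_, ?_, ?_⟩
  · rw [mul_mk, List.take_append_drop, mk_toWord]
  · rw [norm, toWord_mk, (hb.infix (List.take_prefix k _).isInfix).reduce_eq, List.length_take]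
    exact min_eq_left hk
  · rw [norm, toWord_mk, (hb.infix (List.drop_suffix k _).isInfix).reduce_eq, List.length_drop]
    rfl

/-- If half of `b` cancels on either side of `a`, conjugation shortens the pair `(a * b, b)`. -/
theorem exists_conj_norm_add_lt {a b : FreeGroup α} (hb : b ≠ 1) (hle : norm b ≤ norm a)
    (h1 : norm (a * b) = norm a) (h2 : norm (b * a) = norm a) :
    ∃ g : FreeGroup α,
      norm (g * (a * b) * g⁻¹) + norm (g * b * g⁻¹) < norm a + norm b := by
  have hpos : norm b ≠ 0 := by simpa using hb
  have hpar := norm_mul_mod_two a b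
  -- By parity `norm b` is even, so `p` and `q` have equal length.
  obtain ⟨p, q, rfl, hp, hq⟩ := exists_mul_norm_eq b (norm b / 2) (by omega)
  refine ⟨q, ?_⟩
  have e1 : q * (a * (p * q)) * q⁻¹ = q * a * p := by group
  have e2 : q * (p * q) * q⁻¹ = q * p := by group
  rw [e1, e2]
  have h3 := four_point a p q
  have h4 := four_point p q a
  have h5 := four_point' q a p
  have h6 := norm_mul_le q p
  simp only [← mul_assoc] at hpar h1 h2 h3 h4 h5 ⊢
  omega

/-- In a free group a Nielsen reduced family has no cancellation below length two. -/
theorem two_le_norm_prod {ι : Type*} {f : ι × Bool → FreeGroup α}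
    (h0 : ∀ l, f l ≠ 1)
    (h1 : ∀ l m : ι × Bool, (l.1 = m.1 → l.2 = m.2) →
      norm (f l) ≤ norm (f l * f m) ∧ norm (f m) ≤ norm (f l * f m))
    (h2 : ∀ l m n : ι × Bool, (l.1 = m.1 → l.2 = m.2) → (m.1 = n.1 → m.2 = n.2) →
      norm (f l) + norm (f n) < norm (f l * f m) + norm (f m * f n))
    (L : List (ι × Bool)) (l m : ι × Bool) (hL : IsReduced (l :: m :: L)) :
    norm (f l * (f m * (L.map f).prod)) + norm (f m) =
      norm (f l * f m) + norm (f m * (L.map f).prod) ∧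
    2 ≤ norm (f l * (f m * (L.map f).prod)) := by
  induction L generalizing l m with
  | nil =>
    have hlm := (isReduced_cons_cons.1 hL).1
    have hl : norm (f l) ≠ 0 := by simpa using h0 l
    have hm : norm (f m) ≠ 0 := by simpa using h0 m
    have := norm_mul_mod_two (f l) (f m)
    have := h1 l m hlm
    simp only [List.map_nil, List.prod_nil, mul_one, true_and]
    omega
  | cons n L ih =>
    obtain ⟨hlm, hL⟩ := isReduced_cons_cons.1 hL
    obtain ⟨ih1, ih2⟩ := ih m n hL
    have hmn := (isReduced_cons_cons.1 hL).1
    have h3 := h2 l m n hlm hmn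
    have h4 := norm_mul_mul_add_norm (a := f l) (b := f m) (c := f n * (L.map f).prod) (by omega)
    have := h1 l m hlm
    rw [mul_assoc] at h4
    rw [List.map_cons, List.prod_cons]
    omega

/-! ### Nielsen moves and minimal pairs -/

/-- A relation on pairs that is preserved by the elementary Nielsen moves and by simultaneous
conjugation. -/
structure NielsenInvariant {G : Type*} [Group G] (R : G → G → Prop) : Prop where
  swap : ∀ u v, R u v → R v u
  inv : ∀ u v, R u v → R u⁻¹ v
  mul : ∀ u v, R u v → R (u * v) v
  conj : ∀ g u v, R u v → R (g * u * g⁻¹) (g * v * g⁻¹)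

namespace NielsenInvariant

section

variable {G : Type*} [Group G] {R S : G → G → Prop}

theorem inv_right (hR : NielsenInvariant R) {u v : G} (h : R u v) : R u v⁻¹ :=
  hR.swap _ _ (hR.inv _ _ (hR.swap _ _ h))

/-- Each move is undone by a composite of moves. -/
theorem not (hR : NielsenInvariant R) : NielsenInvariant fun u v => ¬ R u v where
  swap _ _ h h' := h (hR.swap _ _ h')
  inv _ _ h h' := h (by simpa using hR.inv _ _ h')
  mul _ _ h h' := h (by simpa using hR.inv_right (hR.mul _ _ (hR.inv_right h')))
  conj g _ _ h h' := h (by simpa [mul_assoc] using hR.conj g⁻¹ _ _ h')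

theorem and (hR : NielsenInvariant R) (hS : NielsenInvariant S) :
    NielsenInvariant fun u v => R u v ∧ S u v where
  swap _ _ h := ⟨hR.swap _ _ h.1, hS.swap _ _ h.2⟩
  inv _ _ h := ⟨hR.inv _ _ h.1, hS.inv _ _ h.2⟩
  mul _ _ h := ⟨hR.mul _ _ h.1, hS.mul _ _ h.2⟩
  conj g _ _ h := ⟨hR.conj g _ _ h.1, hS.conj g _ _ h.2⟩

theorem closure_pair_eq_top :
    NielsenInvariant fun u v : G => Subgroup.closure {u, v} = ⊤ := by
  have key {u v u' v' : G} (h : Subgroup.closure {u, v} = ⊤)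
      (hu : u ∈ Subgroup.closure {u', v'}) (hv : v ∈ Subgroup.closure {u', v'}) :
      Subgroup.closure {u', v'} = ⊤ := by
    rw [eq_top_iff, ← h, Subgroup.closure_le]
    rintro w (rfl | rfl) <;> assumption
  have left (u v : G) : u ∈ Subgroup.closure {u, v} := Subgroup.subset_closure (by simp)
  have right (u v : G) : v ∈ Subgroup.closure {u, v} := Subgroup.subset_closure (by simp)
  refine ⟨fun u v h => key h (right _ _) (left _ _), fun u v h => key h ?_ (right _ _),
    fun u v h => key h ?_ (right _ _), fun g u v h => ?_⟩
  · simpa using Subgroup.inv_mem _ (left u⁻¹ v)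
  · simpa using Subgroup.mul_mem _ (left (u * v) v) (Subgroup.inv_mem _ (right (u * v) v))
  · have := congrArg (Subgroup.map (MulAut.conj g).toMonoidHom) h
    rw [MonoidHom.map_closure, Set.image_pair,
      Subgroup.map_top_of_surjective _ (MulAut.conj g).surjective] at this
    simpa using this

end

/-- A pair of shortest total length among those satisfying `R`. -/
def IsMinimal (R : FreeGroup α → FreeGroup α → Prop) (u v : FreeGroup α) : Prop :=
  R u v ∧ ∀ u' v', R u' v' → norm u + norm v ≤ norm u' + norm v'

variable {R : FreeGroup α → FreeGroup α → Prop}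

theorem exists_isMinimal {u v : FreeGroup α} (h : R u v) : ∃ u' v', IsMinimal R u' v' := by
  obtain ⟨p, hp, hmin⟩ := WellFounded.has_min
    (measure fun p : FreeGroup α × FreeGroup α => norm p.1 + norm p.2).wf
    {p | R p.1 p.2} ⟨(u, v), h⟩
  exact ⟨p.1, p.2, hp, fun u' v' h' => not_lt.1 (hmin (u', v') h')⟩

theorem isMinimal_swap (hR : NielsenInvariant R) {u v : FreeGroup α} (h : IsMinimal R u v) :
    IsMinimal R v u :=
  ⟨hR.swap _ _ h.1, fun u' v' h' => by have := h.2 u' v' h'; omega⟩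

theorem isMinimal_inv (hR : NielsenInvariant R) {u v : FreeGroup α} (h : IsMinimal R u v) :
    IsMinimal R u⁻¹ v :=
  ⟨hR.inv _ _ h.1, fun u' v' h' => by simpa using h.2 u' v' h'⟩

theorem norm_le_norm_mul_left (hR : NielsenInvariant R) {u v : FreeGroup α}
    (h : IsMinimal R u v) : norm u ≤ norm (u * v) := by
  have := h.2 _ _ (hR.mul _ _ h.1)
  omega

theorem norm_le_norm_mul_right (hR : NielsenInvariant R) {u v : FreeGroup α}
    (h : IsMinimal R u v) : norm v ≤ norm (u * v) := by
  have h1 := norm_le_norm_mul_left hR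
    (isMinimal_inv hR (isMinimal_swap hR (isMinimal_inv hR h)))
  rwa [← mul_inv_rev, norm_inv_eq, norm_inv_eq] at h1

theorem norm_mul_ne_or (hR : NielsenInvariant R) {u v : FreeGroup α} (hv : v ≠ 1)
    (h : IsMinimal R u v) : norm (u * v) ≠ norm u ∨ norm (v * u) ≠ norm u := by
  by_contra! hc
  have h1 := norm_le_norm_mul_right hR h
  obtain ⟨g, hg⟩ := exists_conj_norm_add_lt hv (by omega) hc.1 hc.2
  have := h.2 _ _ (hR.conj g _ _ (hR.mul _ _ h.1))
  omega

/-- The letter `l` evaluated at the pair `(u, v)`. -/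
def letter {G : Type*} [Group G] (u v : G) (l : Fin 2 × Bool) : G :=
  cond l.2 (![u, v] l.1) (![u, v] l.1)⁻¹

theorem letter_ne_one {G : Type*} [Group G] {u v : G} (hu : u ≠ 1) (hv : v ≠ 1) (l : Fin 2 × Bool) :
    letter u v l ≠ 1 := by
  obtain ⟨i, b⟩ := l
  fin_cases i <;> cases b <;> simpa [letter]

theorem isMinimal_letter (hR : NielsenInvariant R) {u v : FreeGroup α} (h : IsMinimal R u v)
    {l m : Fin 2 × Bool} (hlm : l.1 ≠ m.1) : IsMinimal R (letter u v l) (letter u v m) := by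
  have s {u v : FreeGroup α} (h : IsMinimal R u v) := isMinimal_swap hR h
  have i {u v : FreeGroup α} (h : IsMinimal R u v) := isMinimal_inv hR h
  have j {u v : FreeGroup α} (h : IsMinimal R u v) : IsMinimal R u v⁻¹ := s (i (s h))
  obtain ⟨k, b⟩ := l
  obtain ⟨k', b'⟩ := m
  fin_cases k <;> fin_cases k' <;> cases b <;> cases b' <;> simp [letter] at hlm ⊢ <;>
    first
      | exact h | exact i h | exact j h | exact i (j h)
      | exact s h | exact s (i h) | exact s (j h) | exact s (i (j h))

theorem norm_letter_le (hR : NielsenInvariant R) {u v : FreeGroup α} (hu : u ≠ 1) (hv : v ≠ 1)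
    (h : IsMinimal R u v) (l m : Fin 2 × Bool) (hlm : l.1 = m.1 → l.2 = m.2) :
    norm (letter u v l) ≤ norm (letter u v l * letter u v m) ∧
      norm (letter u v m) ≤ norm (letter u v l * letter u v m) := by
  by_cases e : l.1 = m.1
  · obtain rfl : l = m := Prod.ext e (hlm e)
    have := norm_lt_norm_mul_self (letter_ne_one hu hv l)
    omega
  · have := isMinimal_letter hR h e
    exact ⟨norm_le_norm_mul_left hR this, norm_le_norm_mul_right hR this⟩

theorem norm_letter_add_lt (hR : NielsenInvariant R) {u v : FreeGroup α} (hu : u ≠ 1)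
    (hv : v ≠ 1) (h : IsMinimal R u v) (l m n : Fin 2 × Bool) (hlm : l.1 = m.1 → l.2 = m.2)
    (hmn : m.1 = n.1 → m.2 = n.2) :
    norm (letter u v l) + norm (letter u v n) <
      norm (letter u v l * letter u v m) + norm (letter u v m * letter u v n) := by
  have h1 := norm_letter_le hR hu hv h l m hlm
  have h2 := norm_letter_le hR hu hv h m n hmn
  have h3 := norm_lt_norm_mul_self (letter_ne_one hu hv m)
  by_cases e : l.1 = m.1
  · obtain rfl : l = m := Prod.ext e (hlm e)
    omega
  by_cases e' : m.1 = n.1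
  · obtain rfl : m = n := Prod.ext e' (hmn e')
    omega
  by_cases e2 : l.2 = n.2
  · obtain rfl : l = n := Prod.ext (by omega) e2
    have := norm_mul_ne_or hR (letter_ne_one hu hv m) (isMinimal_letter hR h e)
    omega
  -- For the pattern `a`, `b`, `a⁻¹`, the four-point condition and `norm b < norm (b * b)` show that
  -- `a * b` or `b * a⁻¹` is longer than `a`.
  · have hn : letter u v n = (letter u v l)⁻¹ := by
      obtain ⟨i, b⟩ := l
      obtain ⟨k, c⟩ := n
      obtain rfl : i = k := by simp only at e e'; omega
      cases b <;> cases c <;> simp [letter] at e2 ⊢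
    rw [hn] at h2 ⊢
    set a := letter u v l
    set b := letter u v m
    have h4 := four_point b b (b⁻¹ * a⁻¹)
    rw [← mul_inv_rev, norm_inv_eq, mul_inv_rev, mul_inv_cancel_left, mul_assoc,
      mul_inv_cancel_left, norm_inv_eq] at h4
    rw [norm_inv_eq] at h2 ⊢
    omega

theorem mem_range_letter (hR : NielsenInvariant R) {u v : FreeGroup α} (hu : u ≠ 1)
    (hv : v ≠ 1) (h : IsMinimal R u v) {w : FreeGroup α} (hw : w ∈ Subgroup.closure {u, v})
    (hw1 : norm w = 1) : ∃ l, w = letter u v l := by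
  have hr : w ∈ (lift ![u, v]).range := by
    rw [range_lift_eq_closure]
    simpa [Set.pair_comm u v] using hw
  obtain ⟨z, rfl⟩ := hr
  have e : lift ![u, v] z = (z.toWord.map (letter u v)).prod := by
    conv_lhs => rw [← mk_toWord (x := z), lift_mk]
    rfl
  have hz := isReduced_toWord (x := z)
  rw [e] at hw1 ⊢
  rcases hL : z.toWord with _ | ⟨l, _ | ⟨m, L⟩⟩ <;> rw [hL] at hw1 hz
  · simp at hw1
  · exact ⟨l, by simp⟩
  · have := (two_le_norm_prod (letter_ne_one hu hv) (norm_letter_le hR hu hv h)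
      (norm_letter_add_lt hR hu hv h) L l m hz).2
    simp only [List.map_cons, List.prod_cons] at hw1
    omega

end NielsenInvariant

end FreeGroup

/-! ### Positive and monotone pairs -/

/-- The pairs obtained from `(a, b)` by swapping and by multiplying the first entry by the
second. -/
inductive PositivePair {G : Type*} [Group G] (a b : G) : G → G → Prop
  | base : PositivePair a b a b
  | swap {s t : G} : PositivePair a b s t → PositivePair a b t s
  | mul {s t : G} : PositivePair a b s t → PositivePair a b (s * t) t

theorem PositivePair.mem_closure {G : Type*} [Group G] {a b s t : G} (h : PositivePair a b s t) :
    s ∈ Submonoid.closure {a, b} ∧ t ∈ Submonoid.closure {a, b} := by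
  induction h with
  | base => exact ⟨Submonoid.subset_closure (by simp), Submonoid.subset_closure (by simp)⟩
  | swap _ ih => exact ih.symm
  | mul _ ih => exact ⟨Submonoid.mul_mem _ ih.1 ih.2, ih.2⟩

/-- The pairs that are, up to simultaneous conjugation and inversion of the entries, positive
pairs in `x^±1` and `y^±1`. -/
def MonotonePair {G : Type*} [Group G] (x y u v : G) : Prop :=
  ∃ a b s t g : G, (a = x ∨ a = x⁻¹) ∧ (b = y ∨ b = y⁻¹) ∧ PositivePair a b s t ∧
    (u = g * s * g⁻¹ ∨ u = (g * s * g⁻¹)⁻¹) ∧ (v = g * t * g⁻¹ ∨ v = (g * t * g⁻¹)⁻¹)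

namespace MonotonePair

variable {G : Type*} [Group G] {x y u v : G}

theorem of_positivePair {a b : G} (ha : a = x ∨ a = x⁻¹) (hb : b = y ∨ b = y⁻¹)
    (h : PositivePair a b u v) : MonotonePair x y u v :=
  ⟨a, b, u, v, 1, ha, hb, h, by simp, by simp⟩

theorem swap (h : MonotonePair x y u v) : MonotonePair x y v u := by
  obtain ⟨a, b, s, t, g, ha, hb, hp, hu, hv⟩ := h
  exact ⟨a, b, t, s, g, ha, hb, hp.swap, hv, hu⟩

theorem inv_left (h : MonotonePair x y u v) : MonotonePair x y u⁻¹ v := by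
  obtain ⟨a, b, s, t, g, ha, hb, hp, hu, hv⟩ := h
  refine ⟨a, b, s, t, g, ha, hb, hp, ?_, hv⟩
  rcases hu with rfl | rfl <;> simp

theorem inv_right (h : MonotonePair x y u v) : MonotonePair x y u v⁻¹ := h.swap.inv_left.swap

theorem conj (k : G) (h : MonotonePair x y u v) :
    MonotonePair x y (k * u * k⁻¹) (k * v * k⁻¹) := by
  obtain ⟨a, b, s, t, g, ha, hb, hp, hu, hv⟩ := h
  refine ⟨a, b, s, t, k * g, ha, hb, hp, ?_, ?_⟩
  · rcases hu with rfl | rfl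
    · left; group
    · right; group
  · rcases hv with rfl | rfl
    · left; group
    · right; group

/-- The mixed-sign case of `mul`. At the base pair a sign of `a` or `b` flips; after a
multiplication the quotient undoes it, up to conjugation by `t⁻¹`. -/
theorem inv_mul_of_positivePair {a b s t : G} (ha : a = x ∨ a = x⁻¹) (hb : b = y ∨ b = y⁻¹)
    (h : PositivePair a b s t) :
    MonotonePair x y (s⁻¹ * t) t ∧ MonotonePair x y (t⁻¹ * s) s := by
  have ha' : a⁻¹ = x ∨ a⁻¹ = x⁻¹ := by rcases ha with rfl | rfl <;> simp
  have hb' : b⁻¹ = y ∨ b⁻¹ = y⁻¹ := by rcases hb with rfl | rfl <;> simp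
  induction h with
  | base =>
    exact ⟨of_positivePair ha' hb (.mul .base), of_positivePair ha hb' (.mul (.swap .base))⟩
  | swap _ ih => exact ih.symm
  | @mul s t h _ =>
    have h1 := (of_positivePair ha hb h).inv_left.conj t⁻¹
    have h2 := (of_positivePair ha hb h.swap.mul.swap).conj t⁻¹
    constructor
    · convert h1 using 1 <;> group
    · convert h2 using 1 <;> group

theorem mul (h : MonotonePair x y u v) : MonotonePair x y (u * v) v := by
  obtain ⟨a, b, s, t, g, ha, hb, hp, hu, hv⟩ := h
  have h1 := (of_positivePair ha hb hp.mul).conj g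
  have h2 := (of_positivePair ha hb hp.mul).conj (g * t)
  have h3 := (inv_mul_of_positivePair ha hb hp).1.conj g
  have h4 := (inv_mul_of_positivePair ha hb hp).1.conj (g * t)
  rcases hu with rfl | rfl <;> rcases hv with rfl | rfl
  · convert h1 using 1; group
  · convert (h4.inv_left.inv_right) using 1 <;> group
  · convert h3 using 1; group
  · convert h2.inv_left.inv_right using 1 <;> group

theorem nielsenInvariant (x y : G) : FreeGroup.NielsenInvariant (MonotonePair x y) :=
  ⟨fun _ _ => swap, fun _ _ => inv_left, fun _ _ => mul, fun g _ _ => conj g⟩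

end MonotonePair

/-! ### Generating pairs and exponent sums -/

namespace F2

theorem closure_x_y : Subgroup.closure {x, y} = (⊤ : Subgroup F2) := by
  rw [← FreeGroup.closure_range_of (Fin 2)]
  congr 1
  ext w
  simp [x, y, eq_comm]

theorem not_commute_x_y : ¬ Commute x y := by
  unfold Commute SemiconjBy x y
  decide

theorem closure_singleton_ne_top (u : F2) : Subgroup.closure {u} ≠ ⊤ := by
  intro h
  obtain ⟨m, hm⟩ := Subgroup.mem_closure_singleton.1 (h ▸ Subgroup.mem_top x)
  obtain ⟨n, hn⟩ := Subgroup.mem_closure_singleton.1 (h ▸ Subgroup.mem_top y)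
  exact not_commute_x_y (hm ▸ hn ▸ Commute.zpow_zpow_self u m n)

open FreeGroup.NielsenInvariant in
/-- Every pair of generators of `F(x, y)` is monotone. -/
theorem monotonePair_of_closure_eq_top {u v : F2} (h : Subgroup.closure {u, v} = ⊤) :
    MonotonePair x y u v := by
  by_contra hc
  have hR := closure_pair_eq_top.and (MonotonePair.nielsenInvariant x y).not
  obtain ⟨u, v, hm⟩ := exists_isMinimal (R := fun u v : F2 =>
    Subgroup.closure {u, v} = ⊤ ∧ ¬ MonotonePair x y u v) ⟨h, hc⟩
  obtain ⟨h, hc⟩ := hm.1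
  have hu : u ≠ 1 := by
    rintro rfl
    rw [Subgroup.closure_insert_one] at h
    exact closure_singleton_ne_top v h
  have hv : v ≠ 1 := by
    rintro rfl
    rw [Set.pair_comm, Subgroup.closure_insert_one] at h
    exact closure_singleton_ne_top u h
  obtain ⟨l, hl⟩ := mem_range_letter hR hu hv hm (w := x) (h ▸ Subgroup.mem_top _)
    (FreeGroup.norm_of 0)
  obtain ⟨m, hm⟩ := mem_range_letter hR hu hv hm (w := y) (h ▸ Subgroup.mem_top _)
    (FreeGroup.norm_of 1)
  apply hc
  have hxy : MonotonePair x y (letter u v l) (letter u v m) :=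
    hl ▸ hm ▸ .of_positivePair (.inl rfl) (.inl rfl) .base
  have hne := not_commute_x_y
  rw [hl, hm] at hne
  obtain ⟨i, b⟩ := l
  obtain ⟨j, c⟩ := m
  fin_cases i <;> fin_cases j <;> simp [letter] at hne hxy
  · exact absurd (by cases b <;> cases c <;> simp [Commute, SemiconjBy]) hne
  · cases b <;> cases c <;> simp at hxy
    · simpa using hxy.inv_left.inv_right
    · simpa using hxy.inv_left
    · simpa using hxy.inv_right
    · exact hxy
  · cases b <;> cases c <;> simp at hxy
    · simpa using hxy.inv_left.inv_right.swap
    · simpa using hxy.inv_left.swap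
    · simpa using hxy.inv_right.swap
    · exact hxy.swap
  · exact absurd (by cases b <;> cases c <;> simp [Commute, SemiconjBy]) hne

theorem exponentSum_mul (i : Fin 2) (u v : F2) :
    exponentSum i (u * v) = exponentSum i u + exponentSum i v := by
  simp [exponentSum]

theorem exponentSum_one (i : Fin 2) : exponentSum i 1 = 0 := by
  simp [exponentSum]

theorem exponentSum_inv (i : Fin 2) (u : F2) : exponentSum i u⁻¹ = -exponentSum i u := by
  simp [exponentSum]

theorem exponentSum_zpow (i : Fin 2) (u : F2) (n : ℤ) :
    exponentSum i (u ^ n) = n * exponentSum i u := by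
  simp [exponentSum]

theorem exponentSum_conj (i : Fin 2) (g u : F2) :
    exponentSum i (g * u * g⁻¹) = exponentSum i u := by
  rw [exponentSum_mul, exponentSum_mul, exponentSum_inv]
  ring

theorem exponentSum_map (θ : F2 →* F2) (i : Fin 2) (w : F2) :
    exponentSum i (θ w) =
      exponentSum 0 w * exponentSum i (θ x) + exponentSum 1 w * exponentSum i (θ y) := by
  induction w using FreeGroup.induction_on with
  | C1 => simp [exponentSum_one]
  | of j => fin_cases j <;> simp [exponentSum, x, y]
  | inv_of j ih => rw [map_inv]; simp only [exponentSum_inv, ih]; ring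
  | mul u v hu hv => rw [map_mul]; simp only [exponentSum_mul, hu, hv]; ring

theorem exponentSumPair_map (θ : F2 →* F2) {p q : F2}
    (h : exponentSumPair p = exponentSumPair q) :
    exponentSumPair (θ p) = exponentSumPair (θ q) := by
  simp only [exponentSumPair, Prod.mk.injEq] at h ⊢
  rw [exponentSum_map θ 0 p, exponentSum_map θ 1 p, exponentSum_map θ 0 q, exponentSum_map θ 1 q,
    h.1, h.2]
  exact ⟨rfl, rfl⟩

/-- In a positive word the `y`-sums of the factors `b` all have the sign `δ` and cannot cancel. -/
theorem mem_zpowers_or_pos_of_mem_closure {a b s : F2} {δ : ℤ} (ha : a ∈ Subgroup.zpowers x)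
    (hb : 0 < δ * exponentSum 1 b) (hs : s ∈ Submonoid.closure {a, b}) :
    s ∈ Subgroup.zpowers x ∨ 0 < δ * exponentSum 1 s := by
  have hx {s : F2} (h : s ∈ Subgroup.zpowers x) : exponentSum 1 s = 0 := by
    obtain ⟨k, rfl⟩ := h
    simp [exponentSum, x]
  induction hs using Submonoid.closure_induction with
  | mem s hs =>
    rcases hs with rfl | rfl
    · exact .inl ha
    · exact .inr hb
  | one => exact .inl (one_mem _)
  | mul s t _ _ ihs iht =>
    rw [exponentSum_mul, mul_add]
    rcases ihs with h | h <;> rcases iht with h' | h'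
    · exact .inl (mul_mem h h')
    · rw [hx h]; right; omega
    · rw [hx h']; right; omega
    · right; omega

theorem isConj_x_of_exponentSumPair {p : F2} (hp : IsPrimitive p)
    (h : exponentSumPair p = (1, 0)) : IsConj x p := by
  obtain ⟨θ, rfl⟩ := hp
  simp only [exponentSumPair, Prod.mk.injEq] at h
  have hθ : Subgroup.closure {θ x, θ y} = ⊤ := by
    have := congrArg (Subgroup.map θ.toMonoidHom) closure_x_y
    rw [MonoidHom.map_closure, Set.image_pair,
      Subgroup.map_top_of_surjective _ θ.surjective] at this
    exact this
  obtain ⟨a, b, s, t, g, ha, hb, hp, hu, -⟩ := monotonePair_of_closure_eq_top hθ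
  have hs : exponentSum 1 s = 0 := by
    have h1 := h.2
    rcases hu with hu | hu <;> rw [hu] at h1
    · rwa [exponentSum_conj] at h1
    · rwa [exponentSum_inv, exponentSum_conj, neg_eq_zero] at h1
  have hax : a ∈ Subgroup.zpowers x := by rcases ha with rfl | rfl <;> simp
  have hsx : s ∈ Subgroup.zpowers x := by
    have hy : exponentSum 1 y = 1 := by simp [exponentSum, y]
    rcases hb with rfl | rfl
    · simpa [hs] using
        mem_zpowers_or_pos_of_mem_closure (δ := 1) hax (by simp [hy]) hp.mem_closure.1
    · simpa [hs] using mem_zpowers_or_pos_of_mem_closure (δ := -1) hax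
        (by simp [exponentSum_inv, hy]) hp.mem_closure.1
  obtain ⟨n, hn⟩ : ∃ n : ℤ, θ x = g * x ^ n * g⁻¹ := by
    obtain ⟨n, rfl⟩ := hsx
    rcases hu with hu | hu
    · exact ⟨n, hu⟩
    · exact ⟨-n, by rw [hu]; group⟩
  have hn1 : n = 1 := by
    have h1 := h.1
    rw [hn, exponentSum_conj, exponentSum_zpow] at h1
    simpa [exponentSum, x] using h1
  rw [hn, hn1, zpow_one]
  exact isConj_iff.2 ⟨g, rfl⟩

end F2

/-- The conjugacy class of a primitive element `p` of `F(x, y)` consists exactly of the primitive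
elements that have the same exponent sum pair as `p`. -/
theorem mainTheorem6 (p : F2) (hp : F2.IsPrimitive p) (q : F2) :
    IsConj p q ↔ F2.IsPrimitive q ∧ F2.exponentSumPair q = F2.exponentSumPair p := by
  obtain ⟨θ, rfl⟩ := hp
  constructor
  · intro h
    obtain ⟨g, rfl⟩ := isConj_iff.1 h
    exact ⟨⟨θ.trans (MulAut.conj g), rfl⟩, by simp [F2.exponentSumPair, F2.exponentSum_conj]⟩
  · rintro ⟨⟨φ, rfl⟩, h⟩
    have h1 := F2.exponentSumPair_map θ.symm.toMonoidHom h
    have h2 : F2.exponentSumPair (θ.symm (φ F2.x)) = (1, 0) := by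
      refine h1.trans ?_
      simp [F2.exponentSumPair, F2.exponentSum, F2.x]
    have h3 := F2.isConj_x_of_exponentSumPair ⟨φ.trans θ.symm, rfl⟩ h2
    simpa using θ.toMonoidHom.map_isConj h3
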